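/- Let $X$ be a complex Banach space, let $BC(\mathbb{R}\to X)$ be the Banach space of bounded continuous functions $u:\mathbb{R}\to X$ with the norm $\|u\|_\infty=\sup_{t\in\mathbb{R}}\|u(t)\|$, and let $D$ be the differentiation operator $Du=u'$ in $BC(\mathbb{R}\to X)$, with domain $\{u\in BC(\mathbb{R}\to X): u \text{ differentiable},\ u'\in BC(\mathbb{R}\to X)\}$. For $\lambda\in\mathbb{C}\setminus i\mathbb{R}$ the operator $\lambda-D$ has a bounded inverse on $BC(\mathbb{R}\to X)$, given by $(\lambda-D)^{-1}u(s)=\int_0^\infty e^{-\lambda t}u(s+t)\,dt$ if $\operatorname{Re}\lambda>0$ and $(\lambda-D)^{-1}u(s)=-\int_0^\infty e^{\lambda t}u(s-t)\,dt$ if $\operatorname{Re}\lambda<0$. For $\varphi\in L^1(\mathbb{R})$ put $\hat\varphi(s)=\int_{\mathbb{R}}e^{-ist}\varphi(t)\,dt$ and $(\varphi*u)(s)=\int_{\mathbb{R}}\varphi(s-t)u(t)\,dt$. The Beurling spectrum of $u\in BC(\mathbb{R}\to X)$ is $$\operatorname{Spec}(u)=\{\xi\in\mathbb{R}:\ \forall\varepsilon>0\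 \exists\varphi\in L^1(\mathbb{R}):\ \operatorname{supp}\hat\varphi\subset(\xi-\varepsilon,\xi+\varepsilon),\ \varphi*u\neq0\}.$$ **Theorem 2.** Let $u\in BC(\mathbb{R}\to X)$ and $\lambda\in\mathbb{C}\setminus i\mathbb{R}$. Then the set $\{|\lambda-i\xi|^{-1}:\xi\in\operatorname{Spec}(u)\}$ is bounded, and $$\lim_{n\to\infty}\bigl\|(\lambda-D)^{-n}u\bigr\|_\infty^{1/n}=\sup\bigl\{|\lambda-i\xi|^{-1}:\ \xi\in\operatorname{Spec}(u)\bigr\},$$ where the supremum of the empty set is read as $0$. If $u\neq0$, then the supremum equals $|\lambda-i\xi_0|^{-1}$ for some $\xi_0\in\operatorname{Spec}(u)$. -/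

import Mathlib

open Filter Topology MeasureTheory Set
open scoped BoundedContinuousFunction

noncomputable section

namespace Beurling

variable {X : Type*} [NormedAddCommGroup X] [NormedSpace ℂ X]

/-- The Fourier transform `s ↦ ∫ e^{-ist} φ(t) dt` (no factor `2π` in the exponent). -/
def fourierHat (φ : ℝ → ℂ) (s : ℝ) : ℂ :=
  ∫ t : ℝ, Complex.exp (-(Complex.I * s * t)) * φ t

/-- The convolution `φ * u` of a scalar function with a vector-valued one. -/
def conv (φ : ℝ → ℂ) (u : ℝ → X) : ℝ → X :=
  convolution φ u (ContinuousLinearMap.lsmul ℂ ℂ) volume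

theorem conv_apply (φ : ℝ → ℂ) (u : ℝ → X) (s : ℝ) :
    conv φ u s = ∫ t : ℝ, φ (s - t) • u t := by
  unfold conv
  rw [convolution_eq_swap]
  rfl

/-- The Beurling spectrum of a bounded continuous function. -/
def Spec (u : ℝ →ᵇ X) : Set ℝ :=
  {ξ : ℝ | ∀ ε : ℝ, 0 < ε → ∃ φ : ℝ → ℂ, Integrable φ ∧
    tsupport (fourierHat φ) ⊆ Ioo (ξ - ε) (ξ + ε) ∧ conv φ u ≠ 0}

/-- The differentiation operator `D` on `BC(ℝ → X)`: its domain consists of the differentiable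
`u` whose derivative is again bounded and continuous, and `D u = u'`. -/
def diffOp (X : Type*) [NormedAddCommGroup X] [NormedSpace ℂ X] :
    (ℝ →ᵇ X) →ₗ.[ℂ] (ℝ →ᵇ X) where
  domain :=
    { carrier := {u | Differentiable ℝ u ∧ Continuous (deriv u) ∧ ∃ C : ℝ, ∀ t, ‖deriv u t‖ ≤ C}
      add_mem' := by
        rintro u v ⟨hu, hu', C, hC⟩ ⟨hv, hv', C', hC'⟩
        have h : deriv (⇑(u + v)) = fun t => deriv u t + deriv v t := by
          funext t
          exact deriv_add (hu t) (hv t)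
        refine ⟨fun t => (hu t).add (hv t), ?_, C + C', fun t => ?_⟩
        · rw [h]; exact hu'.add hv'
        · rw [h]; exact (norm_add_le _ _).trans (add_le_add (hC t) (hC' t))
      zero_mem' := by
        have h : deriv (⇑(0 : ℝ →ᵇ X)) = fun _ => 0 := by
          funext t
          exact deriv_const t (0 : X)
        refine ⟨fun t => differentiableAt_const (0 : X), ?_, 0, fun t => ?_⟩
        · rw [h]; exact continuous_const
        · rw [h]; simp
      smul_mem' := by
        rintro c u ⟨hu, hu', C, hC⟩
        have h : deriv (⇑(c • u)) = fun t => c • deriv u t := by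
          funext t
          exact deriv_const_smul c (hu t)
        refine ⟨fun t => (hu t).const_smul c, ?_, ‖c‖ * C, fun t => ?_⟩
        · rw [h]; exact hu'.const_smul c
        · rw [h, norm_smul]; exact mul_le_mul_of_nonneg_left (hC t) (norm_nonneg c) }
  toFun :=
    { toFun := fun u => BoundedContinuousFunction.ofNormedAddCommGroup (deriv (u : ℝ →ᵇ X))
        u.2.2.1 u.2.2.2.choose u.2.2.2.choose_spec
      map_add' := by
        intro u v
        ext t
        exact deriv_add (u.2.1 t) (v.2.1 t)
      map_smul' := by
        intro c u
        ext t
        exact deriv_const_smul c (u.2.1 t) }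

theorem diffOp_apply (u : (diffOp X).domain) (t : ℝ) :
    diffOp X u t = deriv (u : ℝ →ᵇ X) t := rfl

/-- The values of `(λ - D)⁻¹ u`. -/
def resolventFun (lam : ℂ) (u : ℝ → X) (s : ℝ) : X :=
  if 0 < lam.re then ∫ t in Ioi (0 : ℝ), Complex.exp (-lam * t) • u (s + t)
  else if lam.re < 0 then -∫ t in Ioi (0 : ℝ), Complex.exp (lam * t) • u (s - t)
  else 0

theorem norm_exp_neg_mul (lam : ℂ) (t : ℝ) :
    ‖Complex.exp (-lam * t)‖ = Real.exp (-lam.re * t) := by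
  rw [Complex.norm_exp]; simp

theorem integrable_exp {lam : ℂ} (h : 0 < lam.re) (C : ℝ) :
    IntegrableOn (fun t : ℝ => Real.exp (-lam.re * t) * C) (Ioi 0) :=
  (exp_neg_integrableOn_Ioi 0 h).mul_const C

theorem integral_exp {lam : ℂ} (h : 0 < lam.re) (C : ℝ) :
    ∫ t in Ioi (0 : ℝ), Real.exp (-lam.re * t) * C = |lam.re|⁻¹ * C := by
  rw [integral_mul_const, integral_exp_mul_Ioi (by linarith), abs_of_pos h]
  simp

theorem norm_integrand_le (lam : ℂ) (u : ℝ →ᵇ X) (s t : ℝ) :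
    ‖Complex.exp (-lam * t) • u (s + t)‖ ≤ Real.exp (-lam.re * t) * ‖u‖ := by
  rw [norm_smul, norm_exp_neg_mul]
  exact mul_le_mul_of_nonneg_left (u.norm_coe_le_norm _) (Real.exp_pos _).le

theorem integrable_integrand {lam : ℂ} (h : 0 < lam.re) (u : ℝ →ᵇ X) (s : ℝ) :
    IntegrableOn (fun t : ℝ => Complex.exp (-lam * t) • u (s + t)) (Ioi 0) := by
  refine Integrable.mono' (integrable_exp h ‖u‖) ?_ (ae_of_all _ (norm_integrand_le lam u s))
  have : Continuous fun t : ℝ => Complex.exp (-lam * t) • u (s + t) := by fun_prop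
  exact this.aestronglyMeasurable

/-- The reflection `t ↦ u (-t)`. -/
def reflect (u : ℝ →ᵇ X) : ℝ →ᵇ X := u.compContinuous ⟨fun t => -t, continuous_neg⟩

theorem norm_reflect_le (u : ℝ →ᵇ X) : ‖reflect u‖ ≤ ‖u‖ :=
  (BoundedContinuousFunction.norm_le (norm_nonneg u)).2 fun t => u.norm_coe_le_norm (-t)

theorem resolventFun_of_neg {lam : ℂ} (h : lam.re < 0) (u : ℝ →ᵇ X) (s : ℝ) :
    resolventFun lam u s = -resolventFun (-lam) (reflect u) (-s) := by
  have h' : 0 < (-lam).re := by simpa using h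
  rw [resolventFun, if_neg h.not_gt, if_pos h, resolventFun, if_pos h']
  congr 1
  refine integral_congr_ae (ae_of_all _ fun t => ?_)
  simp [reflect, sub_eq_add_neg, add_comm]

theorem continuous_resolventFun (lam : ℂ) (u : ℝ →ᵇ X) : Continuous (resolventFun lam u) := by
  have pos : ∀ (lam : ℂ) (u : ℝ →ᵇ X), 0 < lam.re → Continuous (resolventFun lam u) := by
    intro lam u h
    have e : resolventFun lam u =
        fun s => ∫ t in Ioi (0 : ℝ), Complex.exp (-lam * t) • u (s + t) := by
      funext s; rw [resolventFun, if_pos h]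
    rw [e]
    refine continuous_of_dominated (fun s => (integrable_integrand h u s).aestronglyMeasurable)
      (fun s => ae_of_all _ (norm_integrand_le lam u s)) (integrable_exp h ‖u‖)
      (ae_of_all _ fun t => ?_)
    fun_prop
  rcases lt_trichotomy lam.re 0 with h | h | h
  · have e : resolventFun lam u = fun s => -resolventFun (-lam) (reflect u) (-s) :=
      funext (resolventFun_of_neg h u)
    rw [e]
    exact ((pos _ _ (by simpa using h)).comp continuous_neg).neg
  · have e : resolventFun lam u = fun _ => 0 := by
      funext s; simp [resolventFun, h]
    rw [e]; exact continuous_const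
  · exact pos _ _ h

theorem norm_resolventFun_le (lam : ℂ) (u : ℝ →ᵇ X) (s : ℝ) :
    ‖resolventFun lam u s‖ ≤ |lam.re|⁻¹ * ‖u‖ := by
  have pos : ∀ (lam : ℂ) (u : ℝ →ᵇ X) (s : ℝ), 0 < lam.re →
      ‖resolventFun lam u s‖ ≤ |lam.re|⁻¹ * ‖u‖ := by
    intro lam u s h
    rw [resolventFun, if_pos h, ← integral_exp h]
    exact norm_integral_le_of_norm_le (integrable_exp h ‖u‖)
      (ae_of_all _ (norm_integrand_le lam u s))
  rcases lt_trichotomy lam.re 0 with h | h | h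
  · rw [resolventFun_of_neg h, norm_neg]
    refine (pos _ _ _ (by simpa using h)).trans ?_
    rw [Complex.neg_re, abs_neg]
    exact mul_le_mul_of_nonneg_left (norm_reflect_le u) (by positivity)
  · simp [resolventFun, h]
  · exact pos _ _ _ h

theorem resolventFun_add (lam : ℂ) (u v : ℝ →ᵇ X) (s : ℝ) :
    resolventFun lam (⇑(u + v)) s = resolventFun lam u s + resolventFun lam v s := by
  have pos : ∀ (lam : ℂ) (u v : ℝ →ᵇ X) (s : ℝ), 0 < lam.re →
      resolventFun lam (⇑(u + v)) s = resolventFun lam u s + resolventFun lam v s := by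
    intro lam u v s h
    simp only [resolventFun, if_pos h]
    rw [← integral_add (integrable_integrand h u s) (integrable_integrand h v s)]
    simp
  rcases lt_trichotomy lam.re 0 with h | h | h
  · have e : reflect (u + v) = reflect u + reflect v := rfl
    rw [resolventFun_of_neg h, resolventFun_of_neg h, resolventFun_of_neg h, e,
      pos _ _ _ _ (by simpa using h), neg_add]
  · simp [resolventFun, h]
  · exact pos _ _ _ _ h

theorem resolventFun_smul (lam c : ℂ) (u : ℝ →ᵇ X) (s : ℝ) :
    resolventFun lam (⇑(c • u)) s = c • resolventFun lam u s := by
  have e : ∀ f : ℝ → ℂ, ∀ g : ℝ → ℝ, ∫ t in Ioi (0 : ℝ), f t • (c • u) (g t) =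
      c • ∫ t in Ioi (0 : ℝ), f t • u (g t) := by
    intro f g
    rw [← integral_smul]
    refine integral_congr_ae (ae_of_all _ fun t => ?_)
    exact smul_comm (f t) c (u (g t))
  unfold resolventFun
  split_ifs
  · exact e _ _
  · rw [e, smul_neg]
  · simp

/-- The bounded operator `(λ - D)⁻¹` on `BC(ℝ → X)` for `λ` off the imaginary axis
(see `resolvent_mem_domain`, `sub_diffOp_resolvent`, `resolvent_sub_diffOp`). -/
def resolvent (X : Type*) [NormedAddCommGroup X] [NormedSpace ℂ X] (lam : ℂ) :
    (ℝ →ᵇ X) →L[ℂ] (ℝ →ᵇ X) :=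
  LinearMap.mkContinuous
    { toFun := fun u => BoundedContinuousFunction.ofNormedAddCommGroup (resolventFun lam u)
        (continuous_resolventFun lam u) _ (norm_resolventFun_le lam u)
      map_add' := fun u v => by
        ext s
        exact resolventFun_add lam u v s
      map_smul' := fun c u => by
        ext s
        exact resolventFun_smul lam c u s }
    |lam.re|⁻¹
    (fun u => BoundedContinuousFunction.norm_ofNormedAddCommGroup_le _
      (by positivity) (norm_resolventFun_le lam u))

theorem resolvent_apply (lam : ℂ) (u : ℝ →ᵇ X) (s : ℝ) :
    resolvent X lam u s = resolventFun lam u s := rfl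

theorem hasDerivAt_exp (c : ℂ) (s : ℝ) :
    HasDerivAt (fun s : ℝ => Complex.exp (c * s)) (c * Complex.exp (c * s)) s := by
  have h : HasDerivAt (fun s : ℝ => c * (s : ℂ)) c s := by
    simpa using (Complex.ofRealCLM.hasDerivAt (x := s)).const_mul c
  simpa [mul_comm] using h.cexp

theorem hasDerivAt_resolventFun [CompleteSpace X] {lam : ℂ} (hlam : lam.re ≠ 0) (u : ℝ →ᵇ X)
    (s : ℝ) : HasDerivAt (resolventFun lam u) (lam • resolventFun lam u s - u s) s := by
  have pos : ∀ (lam : ℂ) (u : ℝ →ᵇ X) (s : ℝ), 0 < lam.re →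
      HasDerivAt (resolventFun lam u) (lam • resolventFun lam u s - u s) s := by
    intro lam u s h
    set f : ℝ → X := fun r => Complex.exp (-lam * r) • u r with hf
    have hfc : Continuous f := by fun_prop
    have hint : ∀ a : ℝ, IntegrableOn f (Ioi a) := fun a => by
      refine Integrable.mono' ((exp_neg_integrableOn_Ioi a h).mul_const ‖u‖)
        hfc.aestronglyMeasurable (ae_of_all _ fun t => ?_)
      simpa [hf] using norm_integrand_le lam u 0 t
    have e : resolventFun lam u = fun s : ℝ =>
        Complex.exp (lam * s) • ((∫ r in Ioi (0 : ℝ), f r) - ∫ r in (0 : ℝ)..s, f r) := by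
      funext s
      have hsub : (∫ r in Ioi (0 : ℝ), f r) - ∫ r in (0 : ℝ)..s, f r = ∫ r in Ioi s, f r := by
        rw [← intervalIntegral.integral_interval_add_Ioi (hint 0) (hint s)]
        abel
      have hshift : ∫ r in Ioi s, f r = ∫ t in Ioi (0 : ℝ), f (s + t) := by
        have hp := (measurePreserving_add_left volume s).setIntegral_preimage_emb
          (measurableEmbedding_addLeft s) f (Ioi s)
        rw [← hp]
        simp
      rw [hsub, hshift, ← integral_smul, resolventFun, if_pos h]
      refine integral_congr_ae (ae_of_all _ fun t => ?_)
      simp only [hf, smul_smul, ← Complex.exp_add]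
      congr 2
      push_cast
      ring
    have hd : HasDerivAt
        (fun s : ℝ => (∫ r in Ioi (0 : ℝ), f r) - ∫ r in (0 : ℝ)..s, f r) (-f s) s :=
      (intervalIntegral.integral_hasDerivAt_right (hfc.intervalIntegrable 0 s)
        (hfc.stronglyMeasurableAtFilter _ _) hfc.continuousAt).const_sub _
    have key := (hasDerivAt_exp lam s).smul hd
    rw [e]
    refine key.congr_deriv ?_
    have h1 : Complex.exp (lam * s) • f s = u s := by
      simp only [hf, smul_smul, ← Complex.exp_add]
      simp
    rw [smul_neg, h1, mul_smul]
    abel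
  rcases lt_or_gt_of_ne hlam with h | h
  · have e : resolventFun lam u = fun s => -resolventFun (-lam) (reflect u) (-s) :=
      funext (resolventFun_of_neg h u)
    have hp := pos (-lam) (reflect u) (-s) (by simpa using h)
    have hc := (hp.scomp s (hasDerivAt_neg s)).neg
    rw [e]
    refine hc.congr_deriv ?_
    have h1 : reflect u (-s) = u s := by simp [reflect]
    rw [h1]
    simp
    abel
  · exact pos _ _ _ h

theorem deriv_resolvent [CompleteSpace X] {lam : ℂ} (hlam : lam.re ≠ 0) (u : ℝ →ᵇ X) :
    deriv (⇑(resolvent X lam u)) = ⇑(lam • resolvent X lam u - u) :=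
  funext fun s => (hasDerivAt_resolventFun hlam u s).deriv

/-- `(λ - D)⁻¹` maps into the domain of `D`. -/
theorem resolvent_mem_domain [CompleteSpace X] {lam : ℂ} (hlam : lam.re ≠ 0) (u : ℝ →ᵇ X) :
    resolvent X lam u ∈ (diffOp X).domain := by
  refine ⟨fun s => (hasDerivAt_resolventFun hlam u s).differentiableAt, ?_,
    ‖lam • resolvent X lam u - u‖, fun s => ?_⟩
  · rw [deriv_resolvent hlam]; exact BoundedContinuousFunction.continuous _
  · rw [deriv_resolvent hlam]; exact BoundedContinuousFunction.norm_coe_le_norm _ s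

/-- `(λ - D) (λ - D)⁻¹ u = u`. -/
theorem sub_diffOp_resolvent [CompleteSpace X] {lam : ℂ} (hlam : lam.re ≠ 0) (u : ℝ →ᵇ X) :
    lam • resolvent X lam u - diffOp X ⟨resolvent X lam u, resolvent_mem_domain hlam u⟩ = u := by
  have h : diffOp X ⟨resolvent X lam u, resolvent_mem_domain hlam u⟩ =
      lam • resolvent X lam u - u := by
    ext s
    rw [diffOp_apply, deriv_resolvent hlam]
  rw [h]; abel

/-- A bounded solution of `z' = λ z` vanishes when `λ` is off the imaginary axis. -/
theorem eq_zero_of_hasDerivAt {lam : ℂ} (hlam : lam.re ≠ 0) (z : ℝ →ᵇ X)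
    (hz : ∀ s, HasDerivAt z (lam • z s) s) : z = 0 := by
  have hw : ∀ s : ℝ, HasDerivAt (fun s : ℝ => Complex.exp (-lam * s) • z s) 0 s := fun s => by
    refine ((hasDerivAt_exp (-lam) s).smul (hz s)).congr_deriv ?_
    rw [smul_smul, ← add_smul]
    have : Complex.exp (-lam * s) * lam + -lam * Complex.exp (-lam * s) = 0 := by ring
    rw [this, zero_smul]
  have hconst : ∀ s t : ℝ, Complex.exp (-lam * s) • z s = Complex.exp (-lam * t) • z t :=
    is_const_of_deriv_eq_zero (fun s => (hw s).differentiableAt) fun s => (hw s).deriv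
  ext t
  have hbound : ∀ s : ℝ, ‖Complex.exp (-lam * t) • z t‖ ≤ Real.exp (-lam.re * s) * ‖z‖ :=
    fun s => by
      rw [← hconst s t]
      simpa using norm_integrand_le lam z 0 s
  have hlim : Tendsto (fun r : ℝ => Real.exp (-r) * ‖z‖) atTop (𝓝 0) := by
    simpa using (Real.tendsto_exp_neg_atTop_nhds_zero).mul_const ‖z‖
  have h0 : ‖Complex.exp (-lam * t) • z t‖ ≤ 0 := by
    refine ge_of_tendsto' hlim fun r => ?_
    have := hbound (r / lam.re)
    have hr : -lam.re * (r / lam.re) = -r := by field_simp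
    rwa [hr] at this
  have h1 : Complex.exp (-lam * t) • z t = 0 := norm_le_zero_iff.1 h0
  simpa using (smul_eq_zero.1 h1).resolve_left (Complex.exp_ne_zero _)

/-- `(λ - D)⁻¹ (λ - D) w = w` for `w` in the domain of `D`. -/
theorem resolvent_sub_diffOp [CompleteSpace X] {lam : ℂ} (hlam : lam.re ≠ 0)
    (w : (diffOp X).domain) :
    resolvent X lam (lam • (w : ℝ →ᵇ X) - diffOp X w) = w := by
  rw [← sub_eq_zero]
  refine eq_zero_of_hasDerivAt hlam _ fun s => ?_
  have h1 := hasDerivAt_resolventFun hlam (lam • (w : ℝ →ᵇ X) - diffOp X w) s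
  have h2 := (w.2.1 s).hasDerivAt
  refine (h1.sub h2).congr_deriv ?_
  simp only [BoundedContinuousFunction.coe_sub, BoundedContinuousFunction.coe_smul, Pi.sub_apply,
    resolvent_apply, diffOp_apply, smul_sub]
  abel

end Beurling

end

/-!
The resolvent `R = (λ - D)⁻¹` is convolution with an integrable kernel, so it commutes with all
convolution operators `u ↦ φ * u`, `φ ∈ L¹`. The two bounds on `‖Rⁿ u‖` come from a Bernstein
inequality and its reverse.

*Lower bound* (`exists_norm_convCLM_le_pow_mul`). If `φ̂` is supported in `(ξ - δ, ξ + δ)`, then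
all `φ * Rⁿ u` are band-limited to that interval, where `D - iξ` has norm `O(δ)`
(`exists_bernstein`). Hence `‖φ * u‖ ≤ (|λ - iξ| + O(δ))ⁿ ‖φ‖₁ ‖Rⁿ u‖`. For `ξ` in the Beurling
spectrum some such `φ * u` is nonzero for every `δ`, so `‖Rⁿ u‖` decays no faster than
`|λ - iξ|⁻ⁿ`.

*Upper bound* (`eventually_norm_resolvent_pow_le`). Let `W` (`annSubspace u`) be the closed
subspace of those `w` with `φ * w = 0` whenever `φ * u = 0`; it contains `u` and is `R`-invariant.
By the resolvent identity the spectrum of `R|W` lies on the circle `{(λ - iξ)⁻¹ : ξ ∈ ℝ} ∪ {0}`,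
which has empty interior, so every spectral point is an approximate eigenvalue. If `ξ` is not in the
Beurling spectrum, some `ψ` with `ψ̂(ξ) = 1` annihilates `W`, and the elementary estimate
`‖w‖ ≤ C ‖(D - iξ) w‖` (`norm_le_of_conv_eq_zero`) shows that `(λ - iξ)⁻¹` is not an approximate
eigenvalue. So the spectral radius of `R|W` is at most the supremum, and Gelfand's formula applies.

If `u ≠ 0`, its Beurling spectrum is nonempty (`Spec_nonempty`): otherwise `‖Rⁿ u‖` would decay
faster than every geometric sequence, which the first estimate with large `δ` forbids. Since the
spectrum is closed and `|λ - iξ|⁻¹ → 0` as `|ξ| → ∞`, the supremum is attained.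
-/

noncomputable section

namespace Beurling

variable {X : Type*} [NormedAddCommGroup X] [NormedSpace ℂ X]

/-! ### Convolution operators on bounded continuous functions -/

theorem conv_apply_swap (φ : ℝ → ℂ) (u : ℝ → X) (s : ℝ) :
    conv φ u s = ∫ t : ℝ, φ t • u (s - t) := rfl

theorem integrable_smul_shift {φ : ℝ → ℂ} (hφ : Integrable φ) (u : ℝ →ᵇ X) (s : ℝ) :
    Integrable fun t : ℝ => φ t • u (s - t) := by
  refine Integrable.mono' (hφ.norm.mul_const ‖u‖) ?_ (ae_of_all _ fun t => ?_)
  · have : Continuous fun t : ℝ => u (s - t) := by fun_prop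
    exact hφ.aestronglyMeasurable.smul this.aestronglyMeasurable
  · rw [norm_smul]
    exact mul_le_mul_of_nonneg_left (u.norm_coe_le_norm _) (norm_nonneg _)

theorem norm_conv_le {φ : ℝ → ℂ} (hφ : Integrable φ) (u : ℝ →ᵇ X) (s : ℝ) :
    ‖conv φ u s‖ ≤ (∫ t, ‖φ t‖) * ‖u‖ := by
  rw [conv_apply_swap, ← integral_mul_const]
  refine norm_integral_le_of_norm_le (hφ.norm.mul_const ‖u‖) (ae_of_all _ fun t => ?_)
  rw [norm_smul]
  exact mul_le_mul_of_nonneg_left (u.norm_coe_le_norm _) (norm_nonneg _)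

omit [NormedSpace ℂ X] in
theorem bddAbove_range_norm (u : ℝ →ᵇ X) : BddAbove (range fun x => ‖u x‖) :=
  ⟨‖u‖, by rintro _ ⟨x, rfl⟩; exact u.norm_coe_le_norm x⟩

theorem continuous_conv {φ : ℝ → ℂ} (hφ : Integrable φ) (u : ℝ →ᵇ X) : Continuous (conv φ u) :=
  (bddAbove_range_norm u).continuous_convolution_right_of_integrable _ hφ u.continuous

/-- Convolution with an integrable function, as a bounded operator on `BC(ℝ → X)`. -/
def convCLM (X : Type*) [NormedAddCommGroup X] [NormedSpace ℂ X] (φ : ℝ → ℂ)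
    (hφ : Integrable φ) : (ℝ →ᵇ X) →L[ℂ] (ℝ →ᵇ X) :=
  LinearMap.mkContinuous
    { toFun := fun u => BoundedContinuousFunction.ofNormedAddCommGroup (conv φ u)
        (continuous_conv hφ u) _ (norm_conv_le hφ u)
      map_add' := fun u v => by
        ext s
        change conv φ (⇑(u + v)) s = conv φ u s + conv φ v s
        simp only [conv_apply_swap]
        rw [← integral_add (integrable_smul_shift hφ u s) (integrable_smul_shift hφ v s)]
        simp
      map_smul' := fun c u => by
        ext s
        change conv φ (⇑(c • u)) s = c • conv φ u s
        simp only [conv_apply_swap]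
        rw [← integral_smul]
        exact integral_congr_ae (ae_of_all _ fun t => smul_comm (φ t) c (u (s - t))) }
    (∫ t, ‖φ t‖)
    (fun u => BoundedContinuousFunction.norm_ofNormedAddCommGroup_le _
      (by positivity) (norm_conv_le hφ u))

theorem convCLM_apply {φ : ℝ → ℂ} (hφ : Integrable φ) (u : ℝ →ᵇ X) (s : ℝ) :
    convCLM X φ hφ u s = conv φ u s := rfl

theorem coe_convCLM {φ : ℝ → ℂ} (hφ : Integrable φ) (u : ℝ →ᵇ X) :
    ⇑(convCLM X φ hφ u) = conv φ u := rfl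

theorem convCLM_eq_zero_iff {φ : ℝ → ℂ} (hφ : Integrable φ) (u : ℝ →ᵇ X) :
    convCLM X φ hφ u = 0 ↔ conv φ u = 0 := by
  rw [← coe_convCLM hφ, DFunLike.ext'_iff]
  rfl

theorem norm_convCLM_apply_le {φ : ℝ → ℂ} (hφ : Integrable φ) (u : ℝ →ᵇ X) :
    ‖convCLM X φ hφ u‖ ≤ (∫ t, ‖φ t‖) * ‖u‖ :=
  (BoundedContinuousFunction.norm_le (by positivity)).2 (norm_conv_le hφ u)

theorem integrable_conv {φ ψ : ℝ → ℂ} (hφ : Integrable φ) (hψ : Integrable ψ) :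
    Integrable (conv φ ψ) :=
  hφ.integrable_convolution _ hψ

theorem conv_comm (φ ψ : ℝ → ℂ) : conv φ ψ = conv ψ φ := by
  funext s
  rw [conv_apply, conv_apply_swap]
  exact integral_congr_ae (ae_of_all _ fun t => mul_comm _ _)

theorem conv_congr_ae {φ ψ : ℝ → ℂ} (h : φ =ᵐ[volume] ψ) (u : ℝ → X) : conv φ u = conv ψ u := by
  funext s
  rw [conv_apply_swap, conv_apply_swap]
  refine integral_congr_ae ?_
  filter_upwards [h] with t ht
  rw [ht]

theorem conv_conv [CompleteSpace X] {φ ψ : ℝ → ℂ} (hφ : Integrable φ) (hψ : Integrable ψ)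
    (u : ℝ →ᵇ X) : conv (conv φ ψ) u = conv φ (conv ψ u) := by
  have hex : ∀ {f : ℝ → ℂ} (_ : Integrable f) (w : ℝ → ℝ) (_ : Continuous w) (C : ℝ)
      (_ : ∀ x, ‖w x‖ ≤ C) (x : ℝ), ConvolutionExistsAt (fun x => ‖f x‖) w x
        (ContinuousLinearMap.mul ℝ ℝ) volume := by
    intro f hf w hw C hC x
    refine Integrable.mono' (hf.norm.mul_const C) ?_ (ae_of_all _ fun t => ?_)
    · have : Continuous fun t : ℝ => w (x - t) := by fun_prop
      exact hf.norm.aestronglyMeasurable.mul this.aestronglyMeasurable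
    · simp only [ContinuousLinearMap.mul_apply', norm_mul, norm_norm]
      exact mul_le_mul_of_nonneg_left (hC _) (norm_nonneg _)
  have hub : BddAbove (range fun x => ‖‖u x‖‖) := by simpa using bddAbove_range_norm u
  funext s
  refine convolution_assoc _ _ _ _ ?_ hφ.aestronglyMeasurable hψ.aestronglyMeasurable
    u.continuous.aestronglyMeasurable ?_ ?_ ?_
  · intro x y z
    exact mul_smul x y z
  · exact (hφ.convolution_integrand _ hψ).prod_right_ae
  · exact ae_of_all _ fun x => hex hψ _ u.continuous.norm ‖u‖
      (fun x => by simpa using u.norm_coe_le_norm x) x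
  · refine hex hφ _ (hub.continuous_convolution_right_of_integrable _ hψ.norm u.continuous.norm)
      ((∫ t, ‖ψ t‖) * ‖u‖) (fun x => ?_) s
    rw [← integral_mul_const]
    refine norm_integral_le_of_norm_le (hψ.norm.mul_const ‖u‖) (ae_of_all _ fun t => ?_)
    simp only [ContinuousLinearMap.mul_apply', norm_mul, norm_norm]
    exact mul_le_mul_of_nonneg_left (u.norm_coe_le_norm _) (norm_nonneg _)

theorem convCLM_convCLM [CompleteSpace X] {φ ψ : ℝ → ℂ} (hφ : Integrable φ) (hψ : Integrable ψ)
    (u : ℝ →ᵇ X) :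
    convCLM X φ hφ (convCLM X ψ hψ u) = convCLM X _ (integrable_conv hφ hψ) u :=
  DFunLike.coe_injective (conv_conv hφ hψ u).symm

theorem convCLM_comm [CompleteSpace X] {φ ψ : ℝ → ℂ} (hφ : Integrable φ) (hψ : Integrable ψ)
    (u : ℝ →ᵇ X) :
    convCLM X φ hφ (convCLM X ψ hψ u) = convCLM X ψ hψ (convCLM X φ hφ u) := by
  rw [convCLM_convCLM, convCLM_convCLM]
  simp only [conv_comm φ ψ]

/-- `(λ - D)⁻¹` is itself a convolution operator. -/
theorem exists_resolvent_eq_convCLM {lam : ℂ} (hlam : lam.re ≠ 0) :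
    ∃ (k : ℝ → ℂ) (hk : Integrable k), ∀ u : ℝ →ᵇ X, resolvent X lam u = convCLM X k hk u := by
  have key : ∀ μ : ℂ, 0 < μ.re →
      IntegrableOn (fun t : ℝ => Complex.exp (-μ * t)) (Ioi 0) := by
    intro μ hμ
    refine Integrable.mono' (exp_neg_integrableOn_Ioi 0 hμ) ?_
      (ae_of_all _ fun t => (norm_exp_neg_mul μ t).le)
    have : Continuous fun t : ℝ => Complex.exp (-μ * t) := by fun_prop
    exact this.aestronglyMeasurable
  rcases lt_or_gt_of_ne hlam with h | h
  · have h' : 0 < (-lam).re := by simpa using h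
    refine ⟨(Ioi (0 : ℝ)).indicator fun t => -Complex.exp (lam * t), ?_, fun u => ?_⟩
    · rw [integrable_indicator_iff measurableSet_Ioi]
      simpa using (key _ h').neg
    · ext s
      rw [resolvent_apply, convCLM_apply, resolventFun, if_neg h.not_gt, if_pos h,
        conv_apply_swap, ← integral_neg, ← integral_indicator measurableSet_Ioi]
      refine integral_congr_ae (ae_of_all _ fun t => ?_)
      by_cases ht : 0 < t <;> simp [indicator, ht]
  · have e : (fun t : ℝ => (Iio (0 : ℝ)).indicator (fun t : ℝ => Complex.exp (lam * t)) t) =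
        fun t : ℝ => (Ioi (0 : ℝ)).indicator (fun t : ℝ => Complex.exp (-lam * t)) (-t) := by
      funext t
      by_cases ht : t < 0 <;> simp [indicator, ht]
    refine ⟨fun t => (Iio (0 : ℝ)).indicator (fun t : ℝ => Complex.exp (lam * t)) t, ?_,
      fun u => ?_⟩
    · rw [e]
      exact ((integrable_indicator_iff measurableSet_Ioi).2 (key _ h)).comp_neg
    · ext s
      rw [resolvent_apply, convCLM_apply, resolventFun, if_pos h, conv_apply_swap,
        ← integral_indicator measurableSet_Ioi, ← integral_neg_eq_self]
      refine integral_congr_ae (ae_of_all _ fun t => ?_)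
      by_cases ht : t < 0 <;> simp [indicator, ht, sub_eq_add_neg]

theorem convCLM_resolvent [CompleteSpace X] {φ : ℝ → ℂ} (hφ : Integrable φ) {lam : ℂ}
    (hlam : lam.re ≠ 0) (u : ℝ →ᵇ X) :
    convCLM X φ hφ (resolvent X lam u) = resolvent X lam (convCLM X φ hφ u) := by
  obtain ⟨k, hk, h⟩ := exists_resolvent_eq_convCLM (X := X) hlam
  rw [h, h, convCLM_comm]

/-! ### The Fourier transform and Bernstein inequalities -/

open scoped FourierTransform SchwartzMap ContDiff

theorem fourierHat_eq_fourier (φ : ℝ → ℂ) (s : ℝ) : fourierHat φ s = 𝓕 φ (s / (2 * Real.pi)) := by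
  rw [Real.fourier_real_eq_integral_exp_smul, fourierHat]
  refine integral_congr_ae (ae_of_all _ fun t => ?_)
  have hpi : (Real.pi : ℂ) ≠ 0 := by exact_mod_cast Real.pi_ne_zero
  simp only [smul_eq_mul]
  congr 2
  push_cast
  field_simp

theorem fourierHat_conv {φ ψ : ℝ → ℂ} (hφ : Integrable φ) (hψ : Integrable ψ) (s : ℝ) :
    fourierHat (conv φ ψ) s = fourierHat φ s * fourierHat ψ s := by
  simp only [fourierHat_eq_fourier]
  exact Real.fourier_smul_convolution_eq hφ hψ _

/-- The Fourier transform is injective on `L¹`, by duality with the Schwartz space. -/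
theorem ae_eq_of_fourierHat_eq {φ ψ : ℝ → ℂ} (hφ : Integrable φ) (hψ : Integrable ψ)
    (h : ∀ s, fourierHat φ s = fourierHat ψ s) : φ =ᵐ[volume] ψ := by
  have h' : 𝓕 φ = 𝓕 ψ := by
    funext s
    have := h (s * (2 * Real.pi))
    rw [fourierHat_eq_fourier, fourierHat_eq_fourier] at this
    rwa [mul_div_cancel_right₀ _ (by positivity)] at this
  refine ae_eq_of_integral_contDiff_smul_eq hφ.locallyIntegrable hψ.locallyIntegrable
    fun g hg hgc => ?_
  have hgc' : HasCompactSupport (fun x => (g x : ℂ)) := hgc.comp_left Complex.ofReal_zero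
  let G : 𝓢(ℝ, ℂ) := hgc'.toSchwartzMap (Complex.ofRealCLM.contDiff.comp hg)
  let H : 𝓢(ℝ, ℂ) := 𝓕⁻ G
  have hG : 𝓕 ⇑H = G := by
    rw [← SchwartzMap.fourier_coe, FourierTransform.fourier_fourierInv_eq]
  have key : ∀ f : ℝ → ℂ, Integrable f → ∫ x, g x • f x = ∫ x, 𝓕 f x • H x := by
    intro f hf
    have := VectorFourier.integral_fourierIntegral_smul_eq_flip (L := innerₗ ℝ)
      Real.continuous_fourierChar continuous_inner hf (H.integrable (μ := volume))
    rw [flip_innerₗ] at this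
    refine Eq.trans ?_ this.symm
    refine integral_congr_ae (ae_of_all _ fun x => ?_)
    have h2 := congrFun hG x
    change _ = f x • 𝓕 ⇑H x
    rw [h2]
    exact (Complex.real_smul).trans (mul_comm _ _)
  rw [key _ hφ, key _ hψ, h']

/-- A Schwartz function whose Fourier transform is a smooth cutoff: `1` on `[-1, 1]` and `0` off
`(-2, 2)`. -/
theorem exists_schwartz_fourierHat :
    ∃ θ : 𝓢(ℝ, ℂ), (∀ s : ℝ, |s| ≤ 1 → fourierHat θ s = 1) ∧
      ∀ s : ℝ, 2 ≤ |s| → fourierHat θ s = 0 := by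
  have hpi : 0 < 2 * Real.pi := by positivity
  let g : ContDiffBump (0 : ℝ) :=
    ⟨1 / (2 * Real.pi), 2 / (2 * Real.pi), by positivity, by gcongr; norm_num⟩
  have hgc : HasCompactSupport (fun x => (g x : ℂ)) :=
    g.hasCompactSupport.comp_left Complex.ofReal_zero
  let G : 𝓢(ℝ, ℂ) := hgc.toSchwartzMap (Complex.ofRealCLM.contDiff.comp g.contDiff)
  let θ : 𝓢(ℝ, ℂ) := 𝓕⁻ G
  have hG : ∀ s, fourierHat θ s = g (s / (2 * Real.pi)) := by
    intro s
    rw [fourierHat_eq_fourier, ← SchwartzMap.fourier_coe, FourierTransform.fourier_fourierInv_eq]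
    rfl
  refine ⟨θ, fun s hs => ?_, fun s hs => ?_⟩
  · rw [hG, g.one_of_mem_closedBall, Complex.ofReal_one]
    rw [mem_closedBall_zero_iff, norm_div, Real.norm_eq_abs, Real.norm_of_nonneg hpi.le]
    exact div_le_div_of_nonneg_right hs hpi.le
  · rw [hG, g.zero_of_le_dist, Complex.ofReal_zero]
    rw [dist_zero_right, norm_div, Real.norm_eq_abs, Real.norm_of_nonneg hpi.le]
    exact div_le_div_of_nonneg_right hs hpi.le

/-- The function `t ↦ δ e^{iξt} θ(δt)`, whose Fourier transform is that of `θ` dilated by `δ` and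
translated by `ξ`. -/
def dilMod (θ : ℝ → ℂ) (ξ δ : ℝ) (t : ℝ) : ℂ :=
  δ * Complex.exp (Complex.I * ξ * t) * θ (δ * t)

theorem integrable_dilMod {θ : ℝ → ℂ} (hθ : Integrable θ) (ξ : ℝ) {δ : ℝ} (hδ : 0 < δ) :
    Integrable (dilMod θ ξ δ) := by
  have h1 : Integrable fun t => θ (δ * t) := hθ.comp_mul_left' hδ.ne'
  refine Integrable.mono' (h1.norm.const_mul δ) ?_ (ae_of_all _ fun t => ?_)
  · refine AEStronglyMeasurable.mul ?_ h1.aestronglyMeasurable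
    have : Continuous fun t : ℝ => (δ : ℂ) * Complex.exp (Complex.I * ξ * t) := by fun_prop
    exact this.aestronglyMeasurable
  · simp only [dilMod, norm_mul, Complex.norm_exp]
    simp [abs_of_pos hδ]

theorem fourierHat_dilMod (θ : ℝ → ℂ) (ξ : ℝ) {δ : ℝ} (hδ : 0 < δ) (s : ℝ) :
    fourierHat (dilMod θ ξ δ) s = fourierHat θ ((s - ξ) / δ) := by
  have h := Measure.integral_comp_mul_left
    (fun t : ℝ => Complex.exp (-(Complex.I * ((s - ξ) / δ : ℝ) * t)) * θ t) δ
  rw [abs_of_pos (inv_pos.2 hδ)] at h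
  have hδ' : (δ : ℂ) ≠ 0 := by exact_mod_cast hδ.ne'
  rw [fourierHat, fourierHat, ← one_smul ℝ (∫ t : ℝ, _ * θ t), ← mul_inv_cancel₀ hδ.ne',
    mul_smul, ← h, ← integral_smul]
  refine integral_congr_ae (ae_of_all _ fun t => ?_)
  simp only [dilMod, Complex.real_smul]
  have : Complex.exp (-(Complex.I * ((s - ξ) / δ : ℝ) * (δ * t : ℝ))) =
      Complex.exp (-(Complex.I * s * t)) * Complex.exp (Complex.I * ξ * t) := by
    rw [← Complex.exp_add]
    congr 1
    push_cast
    field_simp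
    ring
  rw [this]
  ring

theorem tsupport_fourierHat_dilMod {θ : ℝ → ℂ} (hθ : ∀ s : ℝ, 2 ≤ |s| → fourierHat θ s = 0)
    (ξ : ℝ) {δ ε : ℝ} (hδ : 0 < δ) (hε : 2 * δ < ε) :
    tsupport (fourierHat (dilMod θ ξ δ)) ⊆ Ioo (ξ - ε) (ξ + ε) := by
  have h : tsupport (fourierHat (dilMod θ ξ δ)) ⊆ Icc (ξ - 2 * δ) (ξ + 2 * δ) := by
    refine closure_minimal (fun s hs => ?_) isClosed_Icc
    by_contra hs'
    refine hs ?_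
    rw [fourierHat_dilMod θ ξ hδ]
    refine hθ _ ?_
    rw [abs_div, abs_of_pos hδ, le_div_iff₀ hδ]
    by_contra! hlt
    obtain ⟨h1, h2⟩ := abs_lt.1 hlt
    exact hs' ⟨by linarith, by linarith⟩
  exact h.trans (Icc_subset_Ioo (by linarith) (by linarith))

/-- A function whose Fourier transform lives near `ξ` is reproduced by convolution with a
suitable `dilMod θ ξ δ`. -/
theorem conv_dilMod_conv [CompleteSpace X] {θ : ℝ → ℂ} (hθ : Integrable θ)
    (h1 : ∀ s : ℝ, |s| ≤ 1 → fourierHat θ s = 1) {ξ δ : ℝ} (hδ : 0 < δ) {φ : ℝ → ℂ}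
    (hφ : Integrable φ) (hsupp : tsupport (fourierHat φ) ⊆ Ioo (ξ - δ) (ξ + δ)) (u : ℝ →ᵇ X) :
    conv (dilMod θ ξ δ) (conv φ u) = conv φ u := by
  have hK := integrable_dilMod hθ ξ hδ
  rw [← conv_conv hK hφ]
  refine conv_congr_ae (ae_eq_of_fourierHat_eq (integrable_conv hK hφ) hφ fun s => ?_) _
  rw [fourierHat_conv hK hφ]
  by_cases hs : fourierHat φ s = 0
  · rw [hs, mul_zero]
  · have := hsupp (subset_tsupport _ hs)
    rw [fourierHat_dilMod θ ξ hδ, h1, one_mul]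
    rw [abs_div, abs_of_pos hδ, div_le_one hδ, abs_le]
    exact ⟨by linarith [this.1], by linarith [this.2]⟩

/-- Translation is Lipschitz in `L¹` on a Schwartz function. -/
theorem exists_integral_norm_shift_sub_le (θ : 𝓢(ℝ, ℂ)) :
    ∃ C : ℝ, 0 ≤ C ∧ ∀ h : ℝ, |h| ≤ 1 → ∫ x, ‖θ (x + h) - θ x‖ ≤ C * |h| := by
  obtain ⟨C, hC⟩ : ∃ C : ℝ, ∀ y : ℝ, (1 + |y|) ^ 2 * ‖deriv θ y‖ ≤ C := by
    refine ⟨2 ^ 2 * (Finset.Iic (2, 1)).sup (fun m => SchwartzMap.seminorm ℝ m.1 m.2) θ,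
      fun y => ?_⟩
    have := SchwartzMap.one_add_le_sup_seminorm_apply (𝕜 := ℝ) (m := (2, 1)) (k := 2) (n := 1)
      le_rfl le_rfl θ y
    rwa [norm_iteratedFDeriv_eq_norm_iteratedDeriv, iteratedDeriv_one] at this
  have hC0 : 0 ≤ C := le_trans (by positivity) (hC 0)
  have hint : Integrable fun x : ℝ => (1 + ‖x‖) ^ (-2 : ℝ) :=
    integrable_one_add_norm (by simp)
  refine ⟨∫ x : ℝ, 4 * C * (1 + ‖x‖) ^ (-2 : ℝ), by positivity, fun h hh => ?_⟩
  rw [← integral_mul_const]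
  refine integral_mono_of_nonneg (ae_of_all _ fun _ => norm_nonneg _)
    ((hint.const_mul _).mul_const _) (ae_of_all _ fun x => ?_)
  have hbd : ∀ y ∈ Metric.closedBall x |h|, ‖deriv θ y‖ ≤ 4 * C * (1 + ‖x‖) ^ (-2 : ℝ) := by
    intro y hy
    rw [Metric.mem_closedBall, Real.dist_eq] at hy
    have hxy : 1 + |x| ≤ 2 * (1 + |y|) := by
      have := abs_sub_abs_le_abs_sub x y
      rw [abs_sub_comm] at this
      linarith [abs_nonneg y]
    have h2 : (1 + |x|) ^ 2 ≤ 4 * (1 + |y|) ^ 2 := by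
      have := pow_le_pow_left₀ (by positivity) hxy 2
      linarith
    rw [Real.rpow_neg (by positivity), Real.rpow_two, Real.norm_eq_abs, ← div_eq_mul_inv,
      le_div_iff₀ (by positivity)]
    calc ‖deriv θ y‖ * (1 + |x|) ^ 2 ≤ ‖deriv θ y‖ * (4 * (1 + |y|) ^ 2) := by gcongr
      _ = 4 * ((1 + |y|) ^ 2 * ‖deriv θ y‖) := by ring
      _ ≤ 4 * C := by gcongr; exact hC y
  have := (convex_closedBall x |h|).norm_image_sub_le_of_norm_deriv_le
    (fun y _ => θ.differentiableAt) hbd (Metric.mem_closedBall_self (abs_nonneg h))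
    (y := x + h) (by simp)
  simpa using this

/-- Multiplication by `e^{-iξs}` turns `D - iξ` into `D`. -/
theorem hasDerivAt_demodulate {v : ℝ → X} {v' : X} (ξ : ℝ) {s : ℝ} (hv : HasDerivAt v v' s) :
    HasDerivAt (fun s : ℝ => Complex.exp (-(Complex.I * ξ) * s) • v s)
      (Complex.exp (-(Complex.I * ξ) * s) • (v' - (Complex.I * ξ) • v s)) s := by
  refine ((hasDerivAt_exp (-(Complex.I * ξ)) s).smul hv).congr_deriv ?_
  rw [smul_sub, smul_smul, mul_comm (Complex.exp _) (Complex.I * ξ), neg_mul, neg_mul,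
    neg_smul, ← sub_eq_add_neg]

theorem norm_demodulate (ξ s : ℝ) (x : X) : ‖Complex.exp (-(Complex.I * ξ) * s) • x‖ = ‖x‖ := by
  rw [norm_smul, Complex.norm_exp]
  simp

/-- **Bernstein's inequality**: if `v` has frequencies within `O(δ)` of `ξ`, in the sense that it
is reproduced by `dilMod θ ξ δ`, then `(D - iξ) v` is `O(δ)`. -/
theorem exists_bernstein (θ : 𝓢(ℝ, ℂ)) :
    ∃ C : ℝ, 0 ≤ C ∧ ∀ (ξ δ : ℝ), 0 < δ → ∀ (v : ℝ →ᵇ X), conv (dilMod θ ξ δ) v = v →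
      ∀ (s : ℝ) (v' : X), HasDerivAt v v' s → ‖v' - (Complex.I * ξ) • v s‖ ≤ C * δ * ‖v‖ := by
  obtain ⟨C, hC0, hC⟩ := exists_integral_norm_shift_sub_le θ
  refine ⟨C, hC0, fun ξ δ hδ v hv s v' hv' => ?_⟩
  have hp := hasDerivAt_demodulate ξ hv'
  rw [← norm_demodulate ξ s (v' - _)]
  refine hp.le_of_lip' (by positivity) ?_
  -- the demodulated function is reproduced by the unmodulated kernel `δ θ(δ ·)`
  have hrep : ∀ r : ℝ, Complex.exp (-(Complex.I * ξ) * r) • v r =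
      ∫ t, ((δ : ℂ) * θ (δ * (r - t))) • (Complex.exp (-(Complex.I * ξ) * t) • v t) := by
    intro r
    conv_lhs => rw [← hv, conv_apply, ← integral_smul]
    refine integral_congr_ae (ae_of_all _ fun t => ?_)
    simp only [dilMod, smul_smul]
    congr 1
    have : Complex.exp (Complex.I * ξ * ((r - t : ℝ) : ℂ)) =
        Complex.exp (-(Complex.I * ξ) * t) * Complex.exp (Complex.I * ξ * r) := by
      rw [← Complex.exp_add]; congr 1; push_cast; ring
    rw [this]
    have h1 : Complex.exp (-(Complex.I * ξ) * r) * Complex.exp (Complex.I * ξ * r) = 1 := by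
      rw [← Complex.exp_add]; simp
    linear_combination ((δ : ℂ) * θ (δ * (r - t)) * Complex.exp (-(Complex.I * ξ) * t)) * h1
  have hint : ∀ r : ℝ, Integrable fun t => (δ : ℂ) * θ (δ * (r - t)) := fun r =>
    ((θ.integrable.comp_mul_left' hδ.ne').comp_sub_left r).const_mul _
  have hint' : ∀ r : ℝ, Integrable fun t =>
      ((δ : ℂ) * θ (δ * (r - t))) • (Complex.exp (-(Complex.I * ξ) * t) • v t) := by
    intro r
    refine Integrable.mono' ((hint r).norm.mul_const ‖v‖) ?_ (ae_of_all _ fun t => ?_)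
    · refine (hint r).aestronglyMeasurable.smul ?_
      have : Continuous fun t : ℝ => Complex.exp (-(Complex.I * ξ) * t) • v t := by fun_prop
      exact this.aestronglyMeasurable
    · rw [norm_smul, norm_demodulate]
      exact mul_le_mul_of_nonneg_left (v.norm_coe_le_norm _) (norm_nonneg _)
  filter_upwards [Metric.closedBall_mem_nhds s (inv_pos.2 hδ)] with r hr
  rw [Metric.mem_closedBall, Real.dist_eq] at hr
  rw [hrep r, hrep s, ← integral_sub (hint' r) (hint' s)]
  have hdh : |δ * (r - s)| ≤ 1 := by
    rw [abs_mul, abs_of_pos hδ]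
    calc δ * |r - s| ≤ δ * δ⁻¹ := by gcongr
      _ = 1 := mul_inv_cancel₀ hδ.ne'
  have hchange : ∫ t, ‖(δ : ℂ) * θ (δ * (r - t)) - (δ : ℂ) * θ (δ * (s - t))‖ =
      ∫ x, ‖θ (x + δ * (r - s)) - θ x‖ := by
    have e1 := integral_sub_left_eq_self
      (fun y => ‖(δ : ℂ) * θ (δ * (y + (r - s))) - (δ : ℂ) * θ (δ * y)‖) volume s
    have e2 := Measure.integral_comp_mul_left (fun x => ‖θ (x + δ * (r - s)) - θ x‖) δ
    rw [abs_of_pos (inv_pos.2 hδ)] at e2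
    rw [← one_smul ℝ (∫ x, ‖θ (x + δ * (r - s)) - θ x‖), ← mul_inv_cancel₀ hδ.ne', mul_smul, ← e2,
      ← integral_smul]
    calc _ = _ := by
          refine Eq.trans (integral_congr_ae (ae_of_all _ fun t => ?_)) e1
          simp only
          rw [show s - t + (r - s) = r - t by ring]
      _ = _ := by
          refine integral_congr_ae (ae_of_all _ fun t => ?_)
          simp only [← mul_sub, norm_mul, mul_add, smul_eq_mul]
          simp [abs_of_pos hδ]
  calc _ ≤ ∫ t, ‖(δ : ℂ) * θ (δ * (r - t)) - (δ : ℂ) * θ (δ * (s - t))‖ * ‖v‖ := by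
        refine norm_integral_le_of_norm_le (((hint r).sub (hint s)).norm.mul_const ‖v‖)
          (ae_of_all _ fun t => ?_)
        rw [← sub_smul, norm_smul, norm_demodulate]
        exact mul_le_mul_of_nonneg_left (v.norm_coe_le_norm _) (norm_nonneg _)
    _ ≤ C * |δ * (r - s)| * ‖v‖ := by
        rw [integral_mul_const, hchange]
        gcongr
        exact hC _ hdh
    _ = C * δ * ‖v‖ * ‖r - s‖ := by
        rw [abs_mul, abs_of_pos hδ, Real.norm_eq_abs]; ring

/-- The reverse of Bernstein's inequality: a function annihilated by some `ψ` with `ψ̂(ξ) = 1`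
has no frequencies near `ξ`, and is therefore controlled by `(D - iξ) v`. -/
theorem norm_le_of_conv_eq_zero [CompleteSpace X] {ψ : ℝ → ℂ} {ξ : ℝ} (hψ : Integrable ψ)
    (hψ1 : Integrable fun t => ‖ψ t‖ * |t|) (hξ : fourierHat ψ ξ = 1) {v v' : ℝ →ᵇ X}
    (hv : conv ψ v = 0) (hv' : ∀ s, HasDerivAt v (v' s) s) :
    ‖v‖ ≤ (∫ t, ‖ψ t‖ * |t|) * ‖v' - (Complex.I * ξ) • v‖ := by
  refine (BoundedContinuousFunction.norm_le (by positivity)).2 fun s => ?_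
  set p : ℝ → X := fun s => Complex.exp (-(Complex.I * ξ) * s) • v s with hp
  set B := ‖v' - (Complex.I * ξ) • v‖
  have hlip : ∀ t, ‖p s - p (s - t)‖ ≤ B * |t| := by
    intro t
    have := Convex.norm_image_sub_le_of_norm_hasDerivWithin_le (s := univ) (C := B)
      (fun y _ => (hasDerivAt_demodulate ξ (hv' y)).hasDerivWithinAt)
      (fun y _ => by
        rw [norm_demodulate]
        exact (v' - (Complex.I * ξ) • v).norm_coe_le_norm y) convex_univ (mem_univ (s - t))
      (mem_univ s)
    simpa [hp] using this
  have h1 : Integrable fun t : ℝ => (Complex.exp (-(Complex.I * ξ * t)) * ψ t) := by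
    refine Integrable.mono' hψ.norm ?_ (ae_of_all _ fun t => ?_)
    · have : Continuous fun t : ℝ => Complex.exp (-(Complex.I * ξ * t)) := by fun_prop
      exact this.aestronglyMeasurable.mul hψ.aestronglyMeasurable
    · rw [norm_mul, Complex.norm_exp]; simp
  have e1 : p s = ∫ t : ℝ, (Complex.exp (-(Complex.I * ξ * t)) * ψ t) • p s := by
    rw [integral_smul_const]
    change _ = fourierHat ψ ξ • _
    rw [hξ, one_smul]
  have hterm : ∀ t : ℝ, (Complex.exp (-(Complex.I * ξ * t)) * ψ t) • p (s - t) =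
      Complex.exp (-(Complex.I * ξ) * s) • (ψ t • v (s - t)) := by
    intro t
    simp only [hp, smul_smul]
    congr 1
    rw [mul_right_comm, ← Complex.exp_add]
    congr 2
    push_cast
    ring
  have e2 : ∫ t : ℝ, (Complex.exp (-(Complex.I * ξ * t)) * ψ t) • p (s - t) = 0 := by
    simp only [hterm]
    rw [integral_smul, ← conv_apply_swap, hv]
    simp
  have h2 : Integrable fun t : ℝ => (Complex.exp (-(Complex.I * ξ * t)) * ψ t) • p (s - t) := by
    simp only [hterm]
    exact (integrable_smul_shift hψ v s).smul _
  rw [← norm_demodulate ξ s (v s)]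
  change ‖p s‖ ≤ _
  rw [e1, ← sub_zero (∫ t : ℝ, _), ← e2, ← integral_sub (h1.smul_const _) h2, ← integral_mul_const]
  refine norm_integral_le_of_norm_le (hψ1.mul_const _) (ae_of_all _ fun t => ?_)
  rw [← smul_sub, norm_smul, norm_mul, Complex.norm_exp]
  have := hlip t
  have h0 := mul_le_mul_of_nonneg_left this (norm_nonneg (ψ t))
  simp only [Complex.neg_re, Complex.mul_re, Complex.I_re, Complex.ofReal_re, Complex.I_im,
    Complex.ofReal_im, Complex.mul_im]
  simp only [zero_mul, mul_zero, sub_self, neg_zero, Real.exp_zero, one_mul]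
  linarith

theorem integrable_norm_dilMod_mul_abs (θ : 𝓢(ℝ, ℂ)) (ξ : ℝ) {δ : ℝ} (hδ : 0 < δ) :
    Integrable fun t => ‖dilMod θ ξ δ t‖ * |t| := by
  have h := (θ.integrable_pow_mul volume 1).comp_mul_left' hδ.ne'
  refine h.congr (ae_of_all _ fun t => ?_)
  simp only [dilMod, norm_mul, Complex.norm_exp]
  simp [abs_of_pos hδ]
  ring

/-! ### The lower bound -/

theorem hasDerivAt_resolvent [CompleteSpace X] {lam : ℂ} (hlam : lam.re ≠ 0) (u : ℝ →ᵇ X) (s : ℝ) :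
    HasDerivAt (resolvent X lam u) ((lam • resolvent X lam u - u) s) s :=
  hasDerivAt_resolventFun hlam u s

/-- On functions with frequencies in `(ξ - δ, ξ + δ)` the operator `λ - D` has norm at most
`|λ - iξ| + O(δ)`, hence `(λ - D)⁻ⁿ` cannot shrink them faster than the `n`-th power of the
inverse of that number. -/
theorem exists_norm_convCLM_le_pow_mul [CompleteSpace X] (u : ℝ →ᵇ X) {lam : ℂ}
    (hlam : lam.re ≠ 0) :
    ∃ C : ℝ, 0 ≤ C ∧ ∀ (ξ δ : ℝ), 0 < δ → ∀ (φ : ℝ → ℂ) (hφ : Integrable φ),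
      tsupport (fourierHat φ) ⊆ Ioo (ξ - δ) (ξ + δ) → ∀ n : ℕ,
      ‖convCLM X φ hφ u‖ ≤ (‖lam - Complex.I * ξ‖ + C * δ) ^ n *
        ((∫ t, ‖φ t‖) * ‖(resolvent X lam ^ n) u‖) := by
  obtain ⟨θ, h1, -⟩ := exists_schwartz_fourierHat
  obtain ⟨C, hC0, hC⟩ := exists_bernstein (X := X) θ
  refine ⟨C, hC0, fun ξ δ hδ φ hφ hsupp n => ?_⟩
  have hB : 0 ≤ ‖lam - Complex.I * ξ‖ + C * δ := by positivity
  have step : ∀ n : ℕ, ‖convCLM X φ hφ u‖ ≤ (‖lam - Complex.I * ξ‖ + C * δ) ^ n *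
      ‖convCLM X φ hφ ((resolvent X lam ^ n) u)‖ := by
    intro n
    induction n with
    | zero => simp
    | succ n ih =>
      refine ih.trans ?_
      rw [pow_succ, mul_assoc]
      refine mul_le_mul_of_nonneg_left ?_ (pow_nonneg hB n)
      rw [pow_succ', mul_apply_eq_comp, convCLM_resolvent hφ hlam]
      set w := convCLM X φ hφ ((resolvent X lam ^ n) u) with hw
      have hrep : conv (dilMod θ ξ δ) (resolvent X lam w) = resolvent X lam w := by
        rw [hw, ← convCLM_resolvent hφ hlam, coe_convCLM]
        exact conv_dilMod_conv θ.integrable h1 hδ hφ hsupp _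
      refine (BoundedContinuousFunction.norm_le (by positivity)).2 fun s => ?_
      have hb := hC ξ δ hδ _ hrep s _ (hasDerivAt_resolvent hlam w s)
      have e : w s = (lam - Complex.I * ξ) • resolvent X lam w s -
          ((lam • resolvent X lam w - w) s - (Complex.I * ξ) • resolvent X lam w s) := by
        simp only [BoundedContinuousFunction.coe_sub, BoundedContinuousFunction.coe_smul,
          Pi.sub_apply, sub_smul]
        abel
      rw [e, add_mul]
      refine (norm_sub_le _ _).trans (add_le_add ?_ hb)
      rw [norm_smul]
      exact mul_le_mul_of_nonneg_left ((resolvent X lam w).norm_coe_le_norm s) (norm_nonneg _)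
  exact (step n).trans (mul_le_mul_of_nonneg_left (norm_convCLM_apply_le hφ _) (pow_nonneg hB n))

/-- For `ξ` in the Beurling spectrum, the `n`-th roots of `‖(λ - D)⁻ⁿ u‖` stay above every
`b < |λ - iξ|⁻¹` in the limit. -/
theorem exists_mul_pow_le_norm_resolvent_pow [CompleteSpace X] (u : ℝ →ᵇ X) {lam : ℂ}
    (hlam : lam.re ≠ 0) {ξ : ℝ} (hξ : ξ ∈ Spec u) {b : ℝ} (hb0 : 0 < b)
    (hb : b < ‖lam - Complex.I * ξ‖⁻¹) :
    ∃ c : ℝ, 0 < c ∧ ∀ n : ℕ, c * b ^ n ≤ ‖(resolvent X lam ^ n) u‖ := by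
  obtain ⟨C, hC0, hC⟩ := exists_norm_convCLM_le_pow_mul u hlam
  set d := ‖lam - Complex.I * ξ‖
  have hd : d < b⁻¹ := by
    have hd0 : 0 < d := inv_pos.1 (hb0.trans hb)
    exact (lt_inv_comm₀ hb0 hd0).1 hb
  -- `δ` is chosen so that `d + C * δ ≤ b⁻¹`
  set δ := (b⁻¹ - d) / (C + 1)
  have hδ : 0 < δ := div_pos (by linarith) (by linarith)
  have hB : d + C * δ ≤ b⁻¹ := by
    have : (C + 1) * δ = b⁻¹ - d := mul_div_cancel₀ _ (by linarith)
    linarith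
  obtain ⟨φ, hφ, hsupp, hne⟩ := hξ δ hδ
  have hpos : 0 < ‖convCLM X φ hφ u‖ :=
    norm_pos_iff.2 (mt (convCLM_eq_zero_iff hφ u).1 hne)
  have hI : 0 < ∫ t, ‖φ t‖ := by
    have := hC ξ δ hδ φ hφ hsupp 0
    rw [pow_zero, one_mul] at this
    exact pos_of_mul_pos_left (hpos.trans_le this) (norm_nonneg _)
  refine ⟨‖convCLM X φ hφ u‖ / ∫ t, ‖φ t‖, div_pos hpos hI, fun n => ?_⟩
  have h := (hC ξ δ hδ φ hφ hsupp n).trans (mul_le_mul_of_nonneg_right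
    (pow_le_pow_left₀ (by positivity) hB n) (by positivity))
  rw [inv_pow, inv_mul_eq_div, le_div_iff₀ (by positivity)] at h
  rw [div_mul_eq_mul_div, div_le_iff₀ hI]
  linarith

/-! ### Spectral theory of pseudo-resolvents -/

/-- If `t` and `s` satisfy the resolvent identity with parameter difference `a`, then `a⁻¹ - t`
has the inverse `a (1 + a s)`. -/
theorem isUnit_inv_smul_one_sub {A : Type*} [Ring A] [Algebra ℂ A] {a : ℂ} (ha : a ≠ 0) {s t : A}
    (h1 : s = t + a • (t * s)) (h2 : s = t + a • (s * t)) : IsUnit (a⁻¹ • (1 : A) - t) := by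
  have h1' : t * s = a⁻¹ • (s - t) := by
    rw [eq_inv_smul_iff₀ ha, eq_sub_iff_add_eq, add_comm]; exact h1.symm
  have h2' : s * t = a⁻¹ • (s - t) := by
    rw [eq_inv_smul_iff₀ ha, eq_sub_iff_add_eq, add_comm]; exact h2.symm
  refine isUnit_iff_exists.2 ⟨a • (1 + a • s), ?_, ?_⟩
  · simp only [mul_smul_comm, sub_mul, smul_mul_assoc, one_mul, mul_add, mul_one, h1', smul_add,
      smul_sub, smul_smul, mul_inv_cancel₀ ha, mul_one]
    simp
  · simp only [mul_smul_comm, mul_sub, smul_mul_assoc, one_mul, add_mul, mul_one, h2', smul_add,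
      smul_sub, smul_smul, mul_assoc, inv_mul_cancel₀ ha, inv_mul_cancel_left₀ ha,
      mul_inv_cancel₀ ha, mul_one]
    simp

/-- A limit of invertible operators that is bounded below is invertible (a boundary point of the
spectrum is an approximate eigenvalue). -/
theorem isUnit_of_bounded_below {E : Type*} [NormedAddCommGroup E] [NormedSpace ℂ E]
    [CompleteSpace E] {S : E →L[ℂ] E} {c : ℝ} (hc : 0 < c) (hS : ∀ x, ‖x‖ ≤ c * ‖S x‖)
    (hlim : S ∈ closure {S' : E →L[ℂ] E | IsUnit S'}) : IsUnit S := by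
  obtain ⟨_, ⟨S', rfl⟩, hd⟩ := Metric.mem_closure_iff.1 hlim (4 * c)⁻¹ (by positivity)
  rw [dist_eq_norm, norm_sub_rev] at hd
  have hinv : ‖(↑S'⁻¹ : E →L[ℂ] E)‖ ≤ 2 * c := by
    refine ContinuousLinearMap.opNorm_le_bound _ (by positivity) fun y => ?_
    set x := (↑S'⁻¹ : E →L[ℂ] E) y with hx
    have hy : (S' : E →L[ℂ] E) x = y := by
      rw [hx, ← mul_apply_eq_comp, Units.mul_inv]; rfl
    have h1 : ‖S x‖ ≤ ‖y‖ + (4 * c)⁻¹ * ‖x‖ := by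
      have e : S x = y - ((S' : E →L[ℂ] E) - S) x := by
        rw [sub_apply, hy]; abel
      rw [e]
      exact (norm_sub_le _ _).trans (add_le_add_right
        ((ContinuousLinearMap.le_opNorm _ _).trans (by gcongr)) _)
    have h2 : ‖x‖ ≤ c * (‖y‖ + (4 * c)⁻¹ * ‖x‖) := (hS x).trans (by gcongr)
    have h3 : c * ((4 * c)⁻¹ * ‖x‖) = ‖x‖ / 4 := by field_simp
    nlinarith [norm_nonneg x, norm_nonneg y]
  have e : S = S' * (1 - ↑S'⁻¹ * ((S' : E →L[ℂ] E) - S)) := by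
    rw [mul_sub, ← mul_assoc, Units.mul_inv]; simp
  rw [e]
  refine S'.isUnit.mul (isUnit_one_sub_of_norm_lt_one ?_)
  calc _ ≤ ‖(↑S'⁻¹ : E →L[ℂ] E)‖ * ‖(S' : E →L[ℂ] E) - S‖ := norm_mul_le _ _
    _ ≤ 2 * c * (4 * c)⁻¹ := by gcongr
    _ = 1 / 2 := by field_simp; norm_num
    _ < 1 := by norm_num

/-- If `R` satisfies the resolvent identity off the imaginary axis, then the spectrum of `R λ` is
contained in the circle `{(λ - iξ)⁻¹}` together with `0`. A circle has empty interior, so its points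
`μ` belong to the spectrum only if `μ - R λ` fails to be bounded below. -/
theorem norm_le_of_mem_spectrum {E : Type*} [NormedAddCommGroup E] [NormedSpace ℂ E]
    [CompleteSpace E] (R : ∀ z : ℂ, z.re ≠ 0 → E →L[ℂ] E)
    (hR : ∀ z w hz hw x, R w hw x = R z hz x + (z - w) • R z hz (R w hw x))
    {lam : ℂ} (hlam : lam.re ≠ 0) {r : ℝ} (hr : 0 ≤ r)
    (hbd : ∀ μ : ℂ, r < ‖μ‖ → (lam - μ⁻¹).re = 0 →
      ∃ c : ℝ, 0 < c ∧ ∀ x, ‖x‖ ≤ c * ‖μ • x - R lam hlam x‖)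
    {μ : ℂ} (hμ : μ ∈ spectrum ℂ (R lam hlam)) : ‖μ‖ ≤ r := by
  have hunit : ∀ z : ℂ, z.re ≠ 0 → lam - z ≠ 0 →
      IsUnit ((lam - z)⁻¹ • (1 : E →L[ℂ] E) - R lam hlam) := by
    intro z hz hne
    refine isUnit_inv_smul_one_sub hne (s := R z hz) ?_ ?_
    · ext x; exact hR lam z hlam hz x
    · ext x
      have h := hR z lam hz hlam x
      rw [← neg_sub lam z, neg_smul, ← sub_eq_add_neg, eq_sub_iff_add_eq] at h
      exact h.symm
  by_contra! hlt
  have hμ0 : μ ≠ 0 := norm_pos_iff.1 (hr.trans_lt hlt)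
  refine hμ ?_
  change IsUnit (algebraMap ℂ _ μ - _)
  rw [Algebra.algebraMap_eq_smul_one]
  set z : ℂ := lam - μ⁻¹ with hz
  have hzμ : lam - z = μ⁻¹ := by rw [hz]; abel
  by_cases hre : z.re = 0
  · obtain ⟨c, hc, hc'⟩ := hbd μ hlt hre
    refine isUnit_of_bounded_below hc hc' ?_
    -- `z` is approached by `z + t`, `t ≠ 0` real, off the imaginary axis
    have hcont : Tendsto (fun t : ℝ => (lam - (z + t))⁻¹ • (1 : E →L[ℂ] E) - R lam hlam) (𝓝[≠] 0)
        (𝓝 (μ • 1 - R lam hlam)) := by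
      have h1 : Tendsto (fun t : ℝ => (lam - (z + t))⁻¹) (𝓝[≠] 0) (𝓝 μ) := by
        have : ContinuousAt (fun t : ℝ => (lam - (z + t))⁻¹) 0 := by
          refine ContinuousAt.inv₀ (by fun_prop) ?_
          simpa [hzμ] using hμ0
        have h2 := this.tendsto
        simp only [Complex.ofReal_zero, add_zero, hzμ, inv_inv] at h2
        exact h2.mono_left nhdsWithin_le_nhds
      exact (h1.smul_const _).sub_const _
    refine mem_closure_of_tendsto hcont ?_
    have hne : ∀ᶠ t : ℝ in 𝓝[≠] 0, lam - (z + t) ≠ 0 := by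
      have : ContinuousAt (fun t : ℝ => lam - (z + t)) 0 := by fun_prop
      refine (this.eventually_ne ?_).filter_mono nhdsWithin_le_nhds
      simpa [hzμ] using hμ0
    filter_upwards [hne, self_mem_nhdsWithin] with t ht ht0
    exact hunit _ (by simpa [hre] using ht0) ht
  · have := hunit z hre (by rw [hzμ]; exact inv_ne_zero hμ0)
    rwa [hzμ, inv_inv] at this

/-- A consequence of Gelfand's formula. -/
theorem eventually_norm_pow_apply_le {E : Type*} [NormedAddCommGroup E] [NormedSpace ℂ E]
    [CompleteSpace E] (T : E →L[ℂ] E) {r r' : ℝ} (hr : 0 ≤ r) (hr' : r < r')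
    (hT : ∀ μ ∈ spectrum ℂ T, ‖μ‖ ≤ r) : ∀ᶠ n : ℕ in atTop, ∀ x, ‖(T ^ n) x‖ ≤ r' ^ n * ‖x‖ := by
  have hrad : spectralRadius ℂ T < ENNReal.ofReal r' := by
    refine lt_of_le_of_lt (b := ENNReal.ofReal r) (iSup₂_le fun μ hμ => ?_)
      ((ENNReal.ofReal_lt_ofReal_iff (hr.trans_lt hr')).2 hr')
    rw [← enorm_eq_nnnorm, ← ofReal_norm]
    exact ENNReal.ofReal_le_ofReal (hT μ hμ)
  have hG := spectrum.pow_norm_pow_one_div_tendsto_nhds_spectralRadius T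
  filter_upwards [hG.eventually_lt_const hrad, eventually_ne_atTop 0] with n hn hn0 x
  have h1 : ‖T ^ n‖ ^ (1 / n : ℝ) < r' :=
    (ENNReal.ofReal_lt_ofReal_iff (hr.trans_lt hr')).1 hn
  have h2 : ‖T ^ n‖ ≤ r' ^ n := by
    have := pow_le_pow_left₀ (by positivity) h1.le n
    rwa [one_div, Real.rpow_inv_natCast_pow (norm_nonneg _) hn0] at this
  exact ((T ^ n).le_opNorm x).trans (mul_le_mul_of_nonneg_right h2 (norm_nonneg _))

/-! ### The upper bound -/

/-- The functions annihilated by every convolution operator that annihilates `u`: a closed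
subspace containing `u` and invariant under `(λ - D)⁻¹`. -/
def annSubspace (u : ℝ →ᵇ X) : Submodule ℂ (ℝ →ᵇ X) where
  carrier := {w | ∀ (φ : ℝ → ℂ) (hφ : Integrable φ),
    convCLM X φ hφ u = 0 → convCLM X φ hφ w = 0}
  add_mem' := fun hv hw φ hφ h => by rw [map_add, hv φ hφ h, hw φ hφ h, add_zero]
  zero_mem' := fun φ hφ _ => map_zero _
  smul_mem' := fun c w hw φ hφ h => by rw [map_smul, hw φ hφ h, smul_zero]

theorem self_mem_annSubspace (u : ℝ →ᵇ X) : u ∈ annSubspace u := fun _ _ h => h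

theorem isClosed_annSubspace (u : ℝ →ᵇ X) : IsClosed (annSubspace u : Set (ℝ →ᵇ X)) := by
  have : (annSubspace u : Set (ℝ →ᵇ X)) = ⋂ (φ : ℝ → ℂ) (hφ : Integrable φ)
      (_ : convCLM X φ hφ u = 0), {w | convCLM X φ hφ w = 0} := by
    ext w; simp [annSubspace]
  rw [this]
  exact isClosed_iInter fun φ => isClosed_iInter fun hφ => isClosed_iInter fun _ =>
    isClosed_eq (convCLM X φ hφ).continuous continuous_const

instance [CompleteSpace X] (u : ℝ →ᵇ X) : CompleteSpace (annSubspace u) :=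
  (isClosed_annSubspace u).completeSpace_coe

variable [CompleteSpace X]

theorem resolvent_mem_annSubspace (u : ℝ →ᵇ X) {lam : ℂ} (hlam : lam.re ≠ 0) {w : ℝ →ᵇ X}
    (hw : w ∈ annSubspace u) : resolvent X lam w ∈ annSubspace u := fun φ hφ h => by
  rw [convCLM_resolvent hφ hlam, hw φ hφ h, map_zero]

/-- The restriction of `(λ - D)⁻¹` to `annSubspace u`. -/
def resolventAnn (u : ℝ →ᵇ X) (lam : ℂ) (hlam : lam.re ≠ 0) :
    annSubspace u →L[ℂ] annSubspace u :=
  ((resolvent X lam).comp (annSubspace u).subtypeL).codRestrict (annSubspace u)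
    fun w => resolvent_mem_annSubspace u hlam w.2

theorem coe_resolventAnn (u : ℝ →ᵇ X) {lam : ℂ} (hlam : lam.re ≠ 0) (w : annSubspace u) :
    (resolventAnn u lam hlam w : ℝ →ᵇ X) = resolvent X lam w := rfl

theorem coe_resolventAnn_pow (u : ℝ →ᵇ X) {lam : ℂ} (hlam : lam.re ≠ 0) (n : ℕ)
    (w : annSubspace u) :
    ((resolventAnn u lam hlam ^ n) w : ℝ →ᵇ X) = (resolvent X lam ^ n) w := by
  induction n with
  | zero => rfl
  | succ n ih =>
    rw [pow_succ', pow_succ', mul_apply_eq_comp, mul_apply_eq_comp, coe_resolventAnn, ih]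

theorem resolvent_identity {lam z : ℂ} (hlam : lam.re ≠ 0) (hz : z.re ≠ 0) (w : ℝ →ᵇ X) :
    resolvent X z w = resolvent X lam w + (lam - z) • resolvent X lam (resolvent X z w) := by
  have h1 := sub_diffOp_resolvent hz w
  have h2 := resolvent_sub_diffOp hlam ⟨resolvent X z w, resolvent_mem_domain hz w⟩
  have e : lam • resolvent X z w - diffOp X ⟨resolvent X z w, resolvent_mem_domain hz w⟩ =
      w + (lam - z) • resolvent X z w := by
    rw [sub_smul, sub_eq_iff_eq_add.1 h1]; abel
  simp only [e, map_add, map_smul] at h2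
  exact h2.symm

/-- Off the Beurling spectrum, `(λ - iξ)⁻¹ - (λ - D)⁻¹` is bounded below on `annSubspace u`. -/
theorem exists_norm_le_of_notMem_Spec (u : ℝ →ᵇ X) {lam : ℂ} (hlam : lam.re ≠ 0) {ξ : ℝ}
    (hξ : ξ ∉ Spec u) {μ : ℂ} (hμ : μ ≠ 0) (hμξ : lam - Complex.I * ξ = μ⁻¹) :
    ∃ c : ℝ, 0 < c ∧ ∀ w ∈ annSubspace u, ‖w‖ ≤ c * ‖μ • w - resolvent X lam w‖ := by
  obtain ⟨θ, h1, h2⟩ := exists_schwartz_fourierHat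
  simp only [Spec, mem_ofPred_eq, not_forall, not_exists, not_and, not_not] at hξ
  obtain ⟨ε, hε, hφ⟩ := hξ
  have hδ : 0 < ε / 3 := by positivity
  have hK := integrable_dilMod θ.integrable ξ hδ
  set M := ∫ t, ‖dilMod θ ξ (ε / 3) t‖ * |t|
  have hM : 0 ≤ M := integral_nonneg fun t => by positivity
  refine ⟨‖μ⁻¹‖ * (1 + M * ‖μ⁻¹‖),
    mul_pos (norm_pos_iff.2 (inv_ne_zero hμ)) (by positivity), fun w hw => ?_⟩
  set v := resolvent X lam w with hv
  have hKv : conv (dilMod θ ξ (ε / 3)) v = 0 := by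
    rw [← convCLM_eq_zero_iff hK]
    refine resolvent_mem_annSubspace u hlam hw _ hK ((convCLM_eq_zero_iff hK u).2 ?_)
    exact hφ _ hK (tsupport_fourierHat_dilMod h2 ξ hδ (by linarith))
  have hb := norm_le_of_conv_eq_zero hK (integrable_norm_dilMod_mul_abs θ ξ hδ)
    (by rw [fourierHat_dilMod _ _ hδ, sub_self, zero_div, h1 0 (by simp)]) hKv
    (hasDerivAt_resolvent hlam w)
  have e1 : lam • v - w - (Complex.I * ξ) • v = -(μ⁻¹ • (μ • w - v)) := by
    rw [smul_sub, inv_smul_smul₀ hμ, ← hμξ, sub_smul]; abel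
  rw [e1, norm_neg, norm_smul] at hb
  have e2 : w = μ⁻¹ • ((μ • w - v) + v) := by
    rw [sub_add_cancel, inv_smul_smul₀ hμ]
  calc ‖w‖ = ‖μ⁻¹‖ * ‖(μ • w - v) + v‖ := by rw [← norm_smul, ← e2]
    _ ≤ ‖μ⁻¹‖ * (‖μ • w - v‖ + M * (‖μ⁻¹‖ * ‖μ • w - v‖)) := by
        gcongr
        exact (norm_add_le _ _).trans (add_le_add_right hb _)
    _ = _ := by ring

/-- The upper bound, from Gelfand's formula for the restriction of `(λ - D)⁻¹` to
`annSubspace u`. -/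
theorem eventually_norm_resolvent_pow_le (u : ℝ →ᵇ X) {lam : ℂ} (hlam : lam.re ≠ 0) {r : ℝ}
    (hr : 0 ≤ r) (hSpec : ∀ ξ ∈ Spec u, ‖lam - Complex.I * ξ‖⁻¹ ≤ r) {r' : ℝ} (hr' : r < r') :
    ∀ᶠ n : ℕ in atTop, ‖(resolvent X lam ^ n) u‖ ≤ r' ^ n * ‖u‖ := by
  have hbd : ∀ μ : ℂ, r < ‖μ‖ → (lam - μ⁻¹).re = 0 → ∃ c : ℝ, 0 < c ∧
      ∀ w : annSubspace u, ‖w‖ ≤ c * ‖μ • w - resolventAnn u lam hlam w‖ := by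
    intro μ hμ hre
    have hμ0 : μ ≠ 0 := norm_pos_iff.1 (hr.trans_lt hμ)
    have hzI : lam - μ⁻¹ = Complex.I * (lam - μ⁻¹).im := by
      apply Complex.ext <;> simp [hre]
    have hμξ : lam - Complex.I * (lam - μ⁻¹).im = μ⁻¹ := by rw [← hzI]; abel
    have hξ : (lam - μ⁻¹).im ∉ Spec u := fun h => by
      have := hSpec _ h
      rw [hμξ, norm_inv, inv_inv] at this
      exact hμ.not_ge this
    obtain ⟨c, hc, h⟩ := exists_norm_le_of_notMem_Spec u hlam hξ hμ0 hμξ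
    exact ⟨c, hc, fun w => h w w.2⟩
  filter_upwards [eventually_norm_pow_apply_le (resolventAnn u lam hlam) hr hr' fun μ hμ =>
    norm_le_of_mem_spectrum (resolventAnn u)
      (fun z w hz hw x => Subtype.ext (resolvent_identity hz hw (x : ℝ →ᵇ X))) hlam hr hbd hμ]
    with n hn
  rw [← coe_resolventAnn_pow u hlam n ⟨u, self_mem_annSubspace u⟩]
  exact hn ⟨u, self_mem_annSubspace u⟩

/-! ### The spectrum of a nonzero function -/

/-- A nonzero function has a nonzero convolution with a function whose Fourier transform has
compact support. -/
theorem exists_convCLM_ne_zero {u : ℝ →ᵇ X} (hu : u ≠ 0) :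
    ∃ δ : ℝ, 0 < δ ∧ ∃ (φ : ℝ → ℂ) (hφ : Integrable φ),
      tsupport (fourierHat φ) ⊆ Ioo (0 - δ) (0 + δ) ∧ convCLM X φ hφ u ≠ 0 := by
  obtain ⟨θ, h1, h2⟩ := exists_schwartz_fourierHat
  obtain ⟨s, hs⟩ : ∃ s, u s ≠ 0 := by
    by_contra! h
    exact hu (DFunLike.ext _ _ h)
  have e : ∀ δ : ℝ, 0 < δ → conv (dilMod θ 0 δ) u s = ∫ x, θ x • u (s - x / δ) := by
    intro δ hδ
    have h := Measure.integral_comp_mul_left (fun x => θ x • u (s - x / δ)) δ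
    rw [abs_of_pos (inv_pos.2 hδ)] at h
    rw [conv_apply_swap, ← one_smul ℝ (∫ x, θ x • u _), ← mul_inv_cancel₀ hδ.ne', mul_smul, ← h,
      ← integral_smul]
    refine integral_congr_ae (ae_of_all _ fun t => ?_)
    simp only [mul_div_cancel_left₀ _ hδ.ne', dilMod]
    rw [← Complex.coe_smul, smul_smul]
    simp
  have hlim : Tendsto (fun k : ℕ => ∫ x, θ x • u (s - x / (k + 1))) atTop
      (𝓝 (∫ x, θ x • u s)) := by
    refine tendsto_integral_of_dominated_convergence (fun x => ‖θ x‖ * ‖u‖) (fun k => ?_)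
      (θ.integrable.norm.mul_const _) (fun k => ae_of_all _ fun x => ?_) (ae_of_all _ fun x => ?_)
    · have : Continuous fun x : ℝ => θ x • u (s - x / (k + 1)) :=
        θ.continuous.smul (u.continuous.comp (by fun_prop))
      exact this.aestronglyMeasurable
    · rw [norm_smul]
      exact mul_le_mul_of_nonneg_left (u.norm_coe_le_norm _) (norm_nonneg _)
    · have h0 : Tendsto (fun k : ℕ => s - x / ((k : ℝ) + 1)) atTop (𝓝 (s - 0)) :=
        ((tendsto_const_nhds).div_atTop
          (tendsto_natCast_atTop_atTop.atTop_add tendsto_const_nhds)).const_sub s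
      rw [sub_zero] at h0
      exact ((u.continuous.tendsto s).comp h0).const_smul _
  have hval : ∫ x, θ x • u s = u s := by
    rw [integral_smul_const]
    have := h1 0 (by simp)
    rw [fourierHat] at this
    simp only [Complex.ofReal_zero, mul_zero, zero_mul, neg_zero, Complex.exp_zero, one_mul]
      at this
    rw [this, one_smul]
  rw [hval] at hlim
  obtain ⟨k, hk⟩ := (hlim.eventually_ne hs).exists
  have hk0 : (0 : ℝ) < k + 1 := by positivity
  have hK := integrable_dilMod θ.integrable 0 hk0
  refine ⟨3 * (k + 1), by positivity, _, hK,
    tsupport_fourierHat_dilMod h2 0 hk0 (by linarith), fun h0 => hk ?_⟩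
  rw [← e _ hk0, ← convCLM_apply hK, h0]
  rfl

theorem Spec_nonempty {u : ℝ →ᵇ X} (hu : u ≠ 0) : (Spec u).Nonempty := by
  by_contra! hempty
  -- `λ = 1` is enough: if the spectrum were empty, `(1 - D)⁻ⁿ u` would decay superexponentially
  have hlam : (1 : ℂ).re ≠ 0 := by simp
  obtain ⟨δ, hδ, φ, hφ, hsupp, hne⟩ := exists_convCLM_ne_zero hu
  obtain ⟨C, hC0, hC⟩ := exists_norm_convCLM_le_pow_mul u hlam
  set B := ‖(1 : ℂ) - Complex.I * (0 : ℝ)‖ + C * δ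
  have hB : 0 < B := by
    have : ‖(1 : ℂ) - Complex.I * (0 : ℝ)‖ = 1 := by simp
    positivity
  have hup := eventually_norm_resolvent_pow_le u hlam le_rfl (by simp [hempty])
    (show (0 : ℝ) < (2 * B)⁻¹ by positivity)
  have hlim : Tendsto (fun n : ℕ => (1 / 2 : ℝ) ^ n * ((∫ t, ‖φ t‖) * ‖u‖)) atTop (𝓝 0) := by
    simpa using (tendsto_pow_atTop_nhds_zero_of_lt_one (r := (1 / 2 : ℝ)) (by norm_num)
      (by norm_num)).mul_const ((∫ t, ‖φ t‖) * ‖u‖)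
  refine hne (norm_le_zero_iff.1 (ge_of_tendsto hlim ?_))
  filter_upwards [hup] with n hn
  refine (hC 0 δ hδ φ hφ hsupp n).trans ?_
  calc _ ≤ B ^ n * ((∫ t, ‖φ t‖) * ((2 * B)⁻¹ ^ n * ‖u‖)) := by gcongr
    _ = (B * (2 * B)⁻¹) ^ n * ((∫ t, ‖φ t‖) * ‖u‖) := by rw [mul_pow]; ring
    _ = _ := by congr 2; field_simp

omit [CompleteSpace X] in
theorem isClosed_Spec (u : ℝ →ᵇ X) : IsClosed (Spec u) := by
  refine isClosed_of_closure_subset fun ξ hξ ε hε => ?_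
  obtain ⟨η, hη, hd⟩ := Metric.mem_closure_iff.1 hξ (ε / 2) (by positivity)
  obtain ⟨φ, hφ, hsupp, hne⟩ := hη (ε / 2) (by positivity)
  rw [Real.dist_eq, abs_lt] at hd
  exact ⟨φ, hφ, hsupp.trans (Ioo_subset_Ioo (by linarith) (by linarith)), hne⟩

omit [CompleteSpace X] in
theorem Spec_zero : Spec (0 : ℝ →ᵇ X) = ∅ := by
  refine eq_empty_of_forall_notMem fun ξ hξ => ?_
  obtain ⟨φ, -, -, hne⟩ := hξ 1 one_pos
  refine hne (funext fun s => ?_)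
  simp [conv_apply_swap]

theorem exists_isGreatest_image_Spec {u : ℝ →ᵇ X} (hu : u ≠ 0) {lam : ℂ} (hlam : lam.re ≠ 0) :
    ∃ ξ₀ ∈ Spec u, ∀ ξ ∈ Spec u, ‖lam - Complex.I * ξ‖⁻¹ ≤ ‖lam - Complex.I * ξ₀‖⁻¹ := by
  obtain ⟨ξ₁, h₁⟩ := Spec_nonempty hu
  have hcont : Continuous fun ξ : ℝ => ‖lam - Complex.I * ξ‖ := by fun_prop
  have hlarge : ∀ᶠ ξ : ℝ in cocompact ℝ, ‖lam - Complex.I * ξ₁‖ ≤ ‖lam - Complex.I * ξ‖ := by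
    filter_upwards [(tendsto_norm_cocompact_atTop (E := ℝ)).eventually_ge_atTop
      (‖lam - Complex.I * ξ₁‖ + ‖lam‖)] with ξ hξ
    have h := norm_sub_norm_le (Complex.I * ξ) lam
    rw [norm_sub_rev] at h
    simp only [norm_mul, Complex.norm_I, one_mul, Complex.norm_real] at h
    linarith
  obtain ⟨ξ₀, h₀, hmin⟩ := hcont.continuousOn.exists_isMinOn' (isClosed_Spec u) h₁
    (hlarge.filter_mono inf_le_left)
  refine ⟨ξ₀, h₀, fun ξ hξ => inv_anti₀ (norm_pos_iff.2 fun h => hlam ?_) (hmin hξ)⟩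
  simpa using congrArg Complex.re h

/-! ### The spectral radius formula -/

theorem tendsto_mul_pow_rpow_one_div {c b : ℝ} (hc : 0 < c) (hb : 0 ≤ b) :
    Tendsto (fun n : ℕ => (c * b ^ n) ^ (1 / (n : ℝ))) atTop (𝓝 b) := by
  have h : Tendsto (fun n : ℕ => c ^ (1 / (n : ℝ)) * b) atTop (𝓝 (c ^ (0 : ℝ) * b)) :=
    ((Real.continuousAt_const_rpow hc.ne').tendsto.comp
      tendsto_one_div_atTop_nhds_zero_nat).mul_const b
  rw [Real.rpow_zero, one_mul] at h
  refine h.congr' ?_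
  filter_upwards [eventually_ne_atTop 0] with n hn
  rw [Real.mul_rpow hc.le (by positivity), one_div, Real.pow_rpow_inv_natCast hb hn]

theorem tendsto_norm_resolvent_pow {u : ℝ →ᵇ X} (hu : u ≠ 0) {lam : ℂ} (hlam : lam.re ≠ 0)
    {ξ₀ : ℝ} (hξ₀ : ξ₀ ∈ Spec u)
    (hmax : ∀ ξ ∈ Spec u, ‖lam - Complex.I * ξ‖⁻¹ ≤ ‖lam - Complex.I * ξ₀‖⁻¹) :
    Tendsto (fun n : ℕ => ‖(resolvent X lam ^ n) u‖ ^ (1 / (n : ℝ))) atTop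
      (𝓝 ‖lam - Complex.I * ξ₀‖⁻¹) := by
  set r := ‖lam - Complex.I * ξ₀‖⁻¹ with hr_def
  have hr : 0 < r := by
    refine inv_pos.2 (norm_pos_iff.2 fun h => hlam ?_)
    simpa using congrArg Complex.re h
  refine tendsto_order.2 ⟨fun a ha => ?_, fun a ha => ?_⟩
  · obtain ⟨b, hab, hbr⟩ := exists_between (max_lt ha hr)
    obtain ⟨hab, hb0⟩ := max_lt_iff.1 hab
    obtain ⟨c, hc, hcn⟩ := exists_mul_pow_le_norm_resolvent_pow u hlam hξ₀ hb0 hbr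
    filter_upwards [(tendsto_mul_pow_rpow_one_div hc hb0.le).eventually_const_lt hab] with n hn
    exact hn.trans_le (Real.rpow_le_rpow (by positivity) (hcn n) (by positivity))
  · obtain ⟨b, hrb, hba⟩ := exists_between ha
    have hb0 : 0 < b := hr.trans hrb
    filter_upwards [eventually_norm_resolvent_pow_le u hlam hr.le hmax hrb,
      (tendsto_mul_pow_rpow_one_div (norm_pos_iff.2 hu) hb0.le).eventually_lt_const hba]
      with n hn hn'
    rw [mul_comm] at hn
    exact (Real.rpow_le_rpow (norm_nonneg _) hn (by positivity)).trans_lt hn'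

end Beurling

end

theorem theorem2 {X : Type*} [NormedAddCommGroup X] [NormedSpace ℂ X] [CompleteSpace X]
    (u : ℝ →ᵇ X) (lam : ℂ) (hlam : lam.re ≠ 0) :
    BddAbove ((fun ξ : ℝ => ‖lam - Complex.I * ξ‖⁻¹) '' Beurling.Spec u) ∧
    Tendsto (fun n : ℕ => ‖(Beurling.resolvent X lam ^ n) u‖ ^ (1 / (n : ℝ))) atTop
      (𝓝 (sSup ((fun ξ : ℝ => ‖lam - Complex.I * ξ‖⁻¹) '' Beurling.Spec u))) ∧
    (u ≠ 0 → ∃ ξ₀ ∈ Beurling.Spec u,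
      sSup ((fun ξ : ℝ => ‖lam - Complex.I * ξ‖⁻¹) '' Beurling.Spec u) =
        ‖lam - Complex.I * ξ₀‖⁻¹) := by
  by_cases hu : u = 0
  · subst hu
    rw [Beurling.Spec_zero, image_empty, Real.sSup_empty]
    refine ⟨bddAbove_empty, ?_, fun h => absurd rfl h⟩
    refine tendsto_const_nhds.congr' ?_
    filter_upwards [eventually_ne_atTop 0] with n hn
    rw [map_zero, norm_zero, Real.zero_rpow (one_div_ne_zero (Nat.cast_ne_zero.2 hn))]
  · obtain ⟨ξ₀, h₀, hmax⟩ := Beurling.exists_isGreatest_image_Spec hu hlam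
    have hg : IsGreatest ((fun ξ : ℝ => ‖lam - Complex.I * ξ‖⁻¹) '' Beurling.Spec u)
        ‖lam - Complex.I * ξ₀‖⁻¹ :=
      ⟨mem_image_of_mem _ h₀, by rintro _ ⟨ξ, hξ, rfl⟩; exact hmax ξ hξ⟩
    rw [hg.csSup_eq]
    exact ⟨hg.bddAbove, Beurling.tendsto_norm_resolvent_pow hu hlam h₀ hmax,
      fun _ => ⟨ξ₀, h₀, rfl⟩⟩
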